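/- Theorem (completeness of $\mathsf{G3Ldm}$). Let $Ag=\{1,\dots,n\}$ be a finite set of agents, and let $\mathcal L_{\mathsf{Ldm}}$ be the set of formulas in negation normal form $$\phi ::= p \mid \overline p \mid \phi\wedge\phi \mid \phi\vee\phi \mid \Box\phi \mid \Diamond\phi \mid [i]\phi \mid \langle i\rangle\phi ,$$ where $i\in Ag$ and $p$ ranges over a countably infinite set of propositional variables. If $\phi\in\mathcal L_{\mathsf{Ldm}}$ is valid on $\mathsf{Tstit}$-frames, then for every label $x$ the labelled formula $x:\phi$ is derivable in the calculus $\mathsf{G3Ldm}$, which has no cut rule. The notions are as follows. *Semantics.* A $\mathsf{Tstit}$-frame is a nonempty set $W$ with binary relations $R_\Box$, $R_i$ ($i\in Ag$), $R_{Ag}$, $R_{\mathsf G}$, $R_{\mathsf H}$ such that $R_\Box$, all $R_i$ and $R_{Ag}$ are equivalence relations, $R_{\mathsf G}$ is transitive and serial, $R_{\mathsf H}$ is the converse of $R_{\mathsf G}$, and, writing $R(w)=\{v : R\,wv\}$: - (C1) $R_i\subseteq R_\Box$ for each $i \in Ag$; - (C2) if $u_1,\dots,u_n\in W$ and $R_\Box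 u_iu_j$ for all $i,j$, then $\bigcap_i R_i(u_i)\neq\emptyset$; - (C3) $R_{Ag}(w)=\bigcap_{i\in Ag}R_i(w)$ for all $w \in W$; - (C4) if $R_{\mathsf G}wu$ and $R_{\mathsf G}wv$, then $R_{\mathsf G}uv$ or $u=v$ or $R_{\mathsf G}vu$; - (C5) the same for $R_{\mathsf H}$ in place of $R_{\mathsf G}$; - (C6) if $R_{\mathsf G}wu$ and $R_\Box uv$, then there is $z$ with $R_{Ag}wz$ and $R_{\mathsf G}zv$; - (C7) if $R_\Box wu$, then not $R_{\mathsf G}wu$. (If $n=0$, intersections indexed by $Ag$ are equal to $W$.) A model adds a valuation $V$ assigning a subset of $W$ to each variable. Satisfaction is defined by $w\models p$ iff $w\in V(p)$, $w\models\overline p$ iff $w\notin V(p)$, the usual clauses for $\wedge,\vee$, and by reading $\Box,\Diamond$ as "for all" and "for some" $u\in R_\Box(w)$, and $[i],\langle i\rangle$ as "for all" and "for some" $u\in R_i(w)$. A formula is valid if it is satisfied at every world of every model based on a $\mathsf{Tstit}$-frame. *Calculus.* Labels come from a countably infinite set. A sequent consists of a finite multiset of relational atoms $R_\Box xy$, $R_ixy$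 and a finite multiset of labelled formulas $x:\phi$. The rules of $\mathsf{G3Ldm}$ are ($i$ ranges over $Ag$, and premises are written before the slash): - $(\mathsf{id})$: $\ /\ \Gamma, w:p, w:\overline p$; - $(\wedge)$: $\Gamma,w:\phi$ and $\Gamma,w:\psi\ /\ \Gamma,w:\phi\wedge\psi$; - $(\vee)$: $\Gamma,w:\phi,w:\psi\ /\ \Gamma,w:\phi\vee\psi$; - $(\Box)^*$: $\Gamma,R_\Box wv,v:\phi\ /\ \Gamma,w:\Box\phi$; - $(\Diamond)$: $\Gamma,R_\Box wu,w:\Diamond\phi,u:\phi\ /\ \Gamma,R_\Box wu,w:\Diamond\phi$; - $([i])^*$: $\Gamma,R_iwv,v:\phi\ /\ \Gamma,w:[i]\phi$; - $(\langle i\rangle)$: $\Gamma,R_iwu,w:\langle i\rangle\phi,u:\phi\ /\ \Gamma,R_iwu,w:\langle i\rangle\phi$; - $(\mathsf{refl}_\Box)$: $R_\Box ww,\Gamma\ /\ \Gamma$, and $(\mathsf{refl}_{[i]})$: $R_iww,\Gamma\ /\ \Gamma$; - $(\mathsf{eucl}_\Box)$: $R_\Box wu,R_\Box wv,R_\Box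 uv,\Gamma\ /\ R_\Box wu,R_\Box wv,\Gamma$, and $(\mathsf{eucl}_{[i]})$: $R_iwu,R_iwv,R_iuv,\Gamma\ /\ R_iwu,R_iwv,\Gamma$; - $(\mathsf{br}_{[i]})$: $R_\Box wu,R_iwu,\Gamma\ /\ R_iwu,\Gamma$; - $(\mathsf{IOA})^*$: $R_\Box wu_1,\dots,R_\Box wu_n,R_1u_1v,\dots,R_nu_nv,\Gamma\ /\ R_\Box wu_1,\dots,R_\Box wu_n,\Gamma$. In the rules marked $*$, the label $v$ does not occur in the conclusion. -/

import Mathlib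

universe u

namespace Stit

/-- Propositional variables: a countably infinite set. -/
abbrev PVar : Type := ℕ

/-- Labels: a countably infinite set. -/
abbrev Label : Type := ℕ

/-- Formulas of the language of `Ldm`, in negation normal form, over the agents
`Ag = Fin n`. -/
inductive Formula (n : ℕ) : Type
  /-- the positive literal `p` -/
  | pos (p : PVar) : Formula n
  /-- the negative literal `p̄` -/
  | neg (p : PVar) : Formula n
  | and (φ ψ : Formula n) : Formula n
  | or (φ ψ : Formula n) : Formula n
  /-- settledness `□ φ` -/
  | box (φ : Formula n) : Formula n
  /-- its dual `◇ φ` -/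
  | dia (φ : Formula n) : Formula n
  /-- the (Chellas) stit operator `[i] φ` -/
  | stit (i : Fin n) (φ : Formula n) : Formula n
  /-- its dual `⟨i⟩ φ` -/
  | posStit (i : Fin n) (φ : Formula n) : Formula n

/-- Relational temporal STIT frames with agents `Ag = Fin n`; the set of worlds is the
(nonempty) type `W`. -/
structure TstitFrame (n : ℕ) (W : Type u) where
  nonempty : Nonempty W
  Rbox : W → W → Prop
  R : Fin n → W → W → Prop
  RAg : W → W → Prop
  RG : W → W → Prop
  RH : W → W → Prop
  equiv_box : Equivalence Rbox
  equiv_agent : ∀ i, Equivalence (R i)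
  equiv_Ag : Equivalence RAg
  c1 : ∀ i w v, R i w v → Rbox w v
  /-- independence of agents -/
  c2 : ∀ u : Fin n → W, (∀ i j, Rbox (u i) (u j)) → (⋂ i, {v | R i (u i) v}).Nonempty
  c3 : ∀ w, {v | RAg w v} = ⋂ i, {v | R i w v}
  trans_G : ∀ w v z, RG w v → RG v z → RG w z
  serial_G : ∀ w, ∃ v, RG w v
  converse_H : ∀ w v, RH w v ↔ RG v w
  c4 : ∀ w u v, RG w u → RG w v → RG u v ∨ u = v ∨ RG v u
  c5 : ∀ w u v, RH w u → RH w v → RH u v ∨ u = v ∨ RH v u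
  /-- no choice between undivided histories -/
  c6 : ∀ w v, Relation.Comp RG Rbox w v → Relation.Comp RAg RG w v
  c7 : ∀ w u, Rbox w u → ¬ RG w u

/-- A `Tstit`-model: a `Tstit`-frame with a valuation. -/
structure TstitModel (n : ℕ) (W : Type u) extends TstitFrame n W where
  V : PVar → Set W

/-- Satisfaction of an `Ldm`-formula at a world of a `Tstit`-model. -/
def Sat {n : ℕ} {W : Type u} (M : TstitModel n W) : W → Formula n → Prop
  | w, .pos p => w ∈ M.V p
  | w, .neg p => w ∉ M.V p
  | w, .and φ ψ => Sat M w φ ∧ Sat M w ψ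
  | w, .or φ ψ => Sat M w φ ∨ Sat M w ψ
  | w, .box φ => ∀ v, M.Rbox w v → Sat M v φ
  | w, .dia φ => ∃ v, M.Rbox w v ∧ Sat M v φ
  | w, .stit i φ => ∀ v, M.R i w v → Sat M v φ
  | w, .posStit i φ => ∃ v, M.R i w v ∧ Sat M v φ

/-- Validity: truth at every world of every `Tstit`-model (with worlds in `Type u`). -/
def Valid {n : ℕ} (φ : Formula n) : Prop :=
  ∀ (W : Type u) (M : TstitModel n W) (w : W), Sat M w φ

/-- Relational atoms `R_□ x y` and `R_i x y`. -/
inductive RelAtom (n : ℕ) : Type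
  | box (x y : Label) : RelAtom n
  | agent (i : Fin n) (x y : Label) : RelAtom n

/-- Labelled formulas `x : φ`. -/
structure LFormula (n : ℕ) : Type where
  label : Label
  formula : Formula n

/-- The label `v` occurs in a relational atom. -/
def RelAtom.Mentions {n : ℕ} (v : Label) : RelAtom n → Prop
  | .box x y => v = x ∨ v = y
  | .agent _ x y => v = x ∨ v = y

/-- The label `v` does not occur in the sequent consisting of the multiset `𝓡` of relational
atoms and the multiset `Γ` of labelled formulas. -/
def Fresh {n : ℕ} (v : Label) (𝓡 : Multiset (RelAtom n)) (Γ : Multiset (LFormula n)) : Prop :=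
  (∀ a ∈ 𝓡, ¬ a.Mentions v) ∧ ∀ f ∈ Γ, v ≠ f.label

/-- The atoms `R_□ w u₁, …, R_□ w uₙ`. -/
def ioaBox {n : ℕ} (w : Label) (u : Fin n → Label) : Multiset (RelAtom n) :=
  (Finset.univ : Finset (Fin n)).val.map fun i => RelAtom.box w (u i)

/-- The atoms `R_1 u₁ v, …, R_n uₙ v`. -/
def ioaAgent {n : ℕ} (u : Fin n → Label) (v : Label) : Multiset (RelAtom n) :=
  (Finset.univ : Finset (Fin n)).val.map fun i => RelAtom.agent i (u i) v

/-- Derivability in the cut-free labelled calculus `G3Ldm`. A sequent is given by its multiset `𝓡`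
of relational atoms and its multiset `Γ` of labelled formulas. In each rule the premises are
the hypotheses that are themselves derivability statements. -/
inductive G3Ldm {n : ℕ} : Multiset (RelAtom n) → Multiset (LFormula n) → Prop
  | id (𝓡 Γ) (w : Label) (p : PVar) :
      G3Ldm 𝓡 (⟨w, .pos p⟩ ::ₘ ⟨w, .neg p⟩ ::ₘ Γ)
  | and (𝓡 Γ) (w : Label) (φ ψ : Formula n) :
      G3Ldm 𝓡 (⟨w, φ⟩ ::ₘ Γ) → G3Ldm 𝓡 (⟨w, ψ⟩ ::ₘ Γ) →
      G3Ldm 𝓡 (⟨w, .and φ ψ⟩ ::ₘ Γ)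
  | or (𝓡 Γ) (w : Label) (φ ψ : Formula n) :
      G3Ldm 𝓡 (⟨w, φ⟩ ::ₘ ⟨w, ψ⟩ ::ₘ Γ) →
      G3Ldm 𝓡 (⟨w, .or φ ψ⟩ ::ₘ Γ)
  | box (𝓡 Γ) (w v : Label) (φ : Formula n) :
      Fresh v 𝓡 (⟨w, .box φ⟩ ::ₘ Γ) →
      G3Ldm (.box w v ::ₘ 𝓡) (⟨v, φ⟩ ::ₘ Γ) →
      G3Ldm 𝓡 (⟨w, .box φ⟩ ::ₘ Γ)
  | dia (𝓡 Γ) (w u : Label) (φ : Formula n) :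
      G3Ldm (.box w u ::ₘ 𝓡) (⟨u, φ⟩ ::ₘ ⟨w, .dia φ⟩ ::ₘ Γ) →
      G3Ldm (.box w u ::ₘ 𝓡) (⟨w, .dia φ⟩ ::ₘ Γ)
  | stit (𝓡 Γ) (i : Fin n) (w v : Label) (φ : Formula n) :
      Fresh v 𝓡 (⟨w, .stit i φ⟩ ::ₘ Γ) →
      G3Ldm (.agent i w v ::ₘ 𝓡) (⟨v, φ⟩ ::ₘ Γ) →
      G3Ldm 𝓡 (⟨w, .stit i φ⟩ ::ₘ Γ)
  | posStit (𝓡 Γ) (i : Fin n) (w u : Label) (φ : Formula n) :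
      G3Ldm (.agent i w u ::ₘ 𝓡) (⟨u, φ⟩ ::ₘ ⟨w, .posStit i φ⟩ ::ₘ Γ) →
      G3Ldm (.agent i w u ::ₘ 𝓡) (⟨w, .posStit i φ⟩ ::ₘ Γ)
  | reflBox (𝓡 Γ) (w : Label) :
      G3Ldm (.box w w ::ₘ 𝓡) Γ → G3Ldm 𝓡 Γ
  | reflAgent (𝓡 Γ) (i : Fin n) (w : Label) :
      G3Ldm (.agent i w w ::ₘ 𝓡) Γ → G3Ldm 𝓡 Γ
  | ioa (𝓡 Γ) (w : Label) (u : Fin n → Label) (v : Label) :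
      Fresh v (ioaBox w u + 𝓡) Γ →
      G3Ldm (ioaBox w u + ioaAgent u v + 𝓡) Γ →
      G3Ldm (ioaBox w u + 𝓡) Γ
  | euclBox (𝓡 Γ) (w u v : Label) :
      G3Ldm (.box w u ::ₘ .box w v ::ₘ .box u v ::ₘ 𝓡) Γ →
      G3Ldm (.box w u ::ₘ .box w v ::ₘ 𝓡) Γ
  | br (𝓡 Γ) (i : Fin n) (w u : Label) :
      G3Ldm (.box w u ::ₘ .agent i w u ::ₘ 𝓡) Γ →
      G3Ldm (.agent i w u ::ₘ 𝓡) Γ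
  | euclAgent (𝓡 Γ) (i : Fin n) (w u v : Label) :
      G3Ldm (.agent i w u ::ₘ .agent i w v ::ₘ .agent i u v ::ₘ 𝓡) Γ →
      G3Ldm (.agent i w u ::ₘ .agent i w v ::ₘ 𝓡) Γ

end Stit

namespace Stit

/-! Suppose `x : φ` is underivable. Reading the rules from conclusion to premises, an underivable
sequent always has an underivable premise, so proof search can continue forever along an open
branch. A generic sequence of search states makes this branch fair without an explicit schedule: any
requirement that stays attainable from some stage on is eventually met. The union of the branch is
saturated (`SearchState.exists_saturated`), and its labels form a Kripke model in which every
labelled formula of the branch fails.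

The frame conditions on time cost nothing, because the language has no temporal operator.
`LdmModel.toTstit` gives each world its own copy of `ℕ` as history and makes `R_□` and all `R_i`
trivial after moment 0; at moment 0 the modalities are unchanged (`atMomentZero_zero`). The
countermodel thus contradicts validity. -/

/-- A numerical code for formulas. -/
def Formula.code {n : ℕ} : Formula n → ℕ
  | .pos p => Nat.pair 0 p
  | .neg p => Nat.pair 1 p
  | .and φ ψ => Nat.pair 2 (Nat.pair φ.code ψ.code)
  | .or φ ψ => Nat.pair 3 (Nat.pair φ.code ψ.code)
  | .box φ => Nat.pair 4 φ.code
  | .dia φ => Nat.pair 5 φ.code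
  | .stit i φ => Nat.pair 6 (Nat.pair i φ.code)
  | .posStit i φ => Nat.pair 7 (Nat.pair i φ.code)

/-- Countability of formulas lets a single sequence meet all saturation requirements. -/
theorem Formula.code_injective {n : ℕ} : Function.Injective (Formula.code (n := n)) := by
  intro φ
  induction φ <;> intro χ h <;> cases χ <;>
    simp only [Formula.code, Nat.pair_eq_pair, Fin.val_inj] at h <;> grind

instance {n : ℕ} : Countable (Formula n) := Formula.code_injective.countable

instance {n : ℕ} : Countable (LFormula n) :=
  Function.Injective.countable (f := fun f : LFormula n => (f.label, f.formula))
    (by rintro ⟨⟩ ⟨⟩ h; simpa using h)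

/-- The agent (if any) and the two labels of a relational atom. -/
def RelAtom.components {n : ℕ} : RelAtom n → Option (Fin n) × Label × Label
  | .box x y => (none, x, y)
  | .agent i x y => (some i, x, y)

instance {n : ℕ} : Countable (RelAtom n) :=
  Function.Injective.countable (f := RelAtom.components)
    (by rintro ⟨⟩ ⟨⟩ h <;> simp_all [RelAtom.components])

/-! ### Generic sequences -/

/-- A generic increasing sequence: each of countably many properties holds somewhere along the
sequence, unless from some point on no extension has it. -/
theorem exists_generic_sequence {α ι : Type*} [Preorder α] [Countable ι] (P : ι → α → Prop)
    (a : α) : ∃ s : ℕ → α, Monotone s ∧ s 0 = a ∧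
      ∀ i, (∃ k₀, ∀ k ≥ k₀, ∃ b, s k ≤ b ∧ P i b) → ∃ k, P i (s k) := by
  have := Encodable.ofCountable ι
  -- The elements that decide `P i`: it holds there, or no extension satisfies it.
  let D : ι → Order.Cofinal α := fun i =>
    { carrier := {b | P i b ∨ ∀ c, b ≤ c → ¬ P i c}
      isCofinal := by
        intro b
        by_cases h : ∃ c, b ≤ c ∧ P i c
        · obtain ⟨c, hc, hP⟩ := h
          exact ⟨c, Or.inl hP, hc⟩
        · push Not at h
          exact ⟨b, Or.inr h, le_rfl⟩ }
  have hmono := Order.sequenceOfCofinals.monotone a D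
  refine ⟨Order.sequenceOfCofinals a D, hmono, rfl, fun i ⟨k₀, hk⟩ => ?_⟩
  rcases Order.sequenceOfCofinals.encode_mem a D i with h | h
  · exact ⟨_, h⟩
  · obtain ⟨b, hb, hP⟩ := hk (max k₀ (Encodable.encode i + 1)) (le_max_left _ _)
    exact absurd hP (h b ((hmono (le_max_right _ _)).trans hb))

/-! ### Temporal frames from frames for `Ldm` -/

/-- Kripke models for the atemporal logic `Ldm`. -/
structure LdmModel (n : ℕ) (W : Type u) where
  nonempty : Nonempty W
  Rbox : W → W → Prop
  R : Fin n → W → W → Prop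
  equiv_box : Equivalence Rbox
  equiv_agent : ∀ i, Equivalence (R i)
  c1 : ∀ i w v, R i w v → Rbox w v
  c2 : ∀ u : Fin n → W, (∀ i j, Rbox (u i) (u j)) → ∃ v, ∀ i, R i (u i) v
  V : PVar → Set W

/-- Relate the points of moment `0` by `r`, and points of later moments only to themselves. -/
def atMomentZero {W : Type u} (r : W → W → Prop) (a b : W × ℕ) : Prop :=
  a.2 = b.2 ∧ (a.2 = 0 ∧ r a.1 b.1 ∨ a.1 = b.1)

theorem equivalence_atMomentZero {W : Type u} {r : W → W → Prop} (h : Equivalence r) :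
    Equivalence (atMomentZero r) where
  refl a := ⟨rfl, Or.inr rfl⟩
  symm := by
    rintro ⟨x, k⟩ ⟨y, l⟩ ⟨h₁, h₂⟩
    refine ⟨h₁.symm, ?_⟩
    rcases h₂ with ⟨h₂, h₃⟩ | h₂
    · exact Or.inl ⟨h₁ ▸ h₂, h.symm h₃⟩
    · exact Or.inr h₂.symm
  trans := by
    rintro ⟨x, k⟩ ⟨y, l⟩ ⟨z, m⟩ ⟨h₁, h₂⟩ ⟨h₃, h₄⟩
    simp only at h₁ h₂ h₃ h₄
    subst h₁ h₃
    refine ⟨rfl, ?_⟩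
    rcases h₂ with ⟨h₂, h₅⟩ | rfl
    · rcases h₄ with ⟨-, h₆⟩ | rfl
      · exact Or.inl ⟨h₂, h.trans h₅ h₆⟩
      · exact Or.inl ⟨h₂, h₅⟩
    · exact h₄

/-- The temporal unravelling of a model for `Ldm`: every world starts a history of its own, of
order type `ℕ`, and all choices are made at the first moment. -/
def LdmModel.toTstit {n : ℕ} {W : Type u} (M : LdmModel n W) : TstitModel n (W × ℕ) where
  nonempty := let ⟨w⟩ := M.nonempty; ⟨(w, 0)⟩
  Rbox := atMomentZero M.Rbox
  R i := atMomentZero (M.R i)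
  RAg a b := ∀ i, atMomentZero (M.R i) a b
  RG a b := a.1 = b.1 ∧ a.2 < b.2
  RH a b := b.1 = a.1 ∧ b.2 < a.2
  equiv_box := equivalence_atMomentZero M.equiv_box
  equiv_agent i := equivalence_atMomentZero (M.equiv_agent i)
  equiv_Ag :=
    { refl := fun a i => (equivalence_atMomentZero (M.equiv_agent i)).refl a
      symm := fun h i => (equivalence_atMomentZero (M.equiv_agent i)).symm (h i)
      trans := fun h h' i => (equivalence_atMomentZero (M.equiv_agent i)).trans (h i) (h' i) }
  c1 i a b h := ⟨h.1, h.2.imp (fun h' => ⟨h'.1, M.c1 i _ _ h'.2⟩) id⟩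
  c2 u hu := by
    rcases isEmpty_or_nonempty (Fin n) with _ | ⟨⟨i₀⟩⟩
    · obtain ⟨w⟩ := M.nonempty
      exact ⟨(w, 0), by simp⟩
    -- All `u i` lie at one moment. At moment 0 independence is that of `M`; later, `R_□` is
    -- equality and all `u i` coincide.
    by_cases h0 : (u i₀).2 = 0
    · obtain ⟨v, hv⟩ := M.c2 (fun i => (u i).1) fun i j => by
        rcases (hu i j).2 with h | h
        · exact h.2
        · exact h ▸ M.equiv_box.refl _
      have hz : ∀ i, (u i).2 = 0 := fun i => (hu i i₀).1.trans h0
      exact ⟨(v, 0), Set.mem_iInter.2 fun i => ⟨hz i, Or.inl ⟨hz i, hv i⟩⟩⟩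
    · refine ⟨u i₀, Set.mem_iInter.2 fun i => ⟨(hu i i₀).1, Or.inr ?_⟩⟩
      rcases (hu i i₀).2 with h | h
      · exact absurd ((hu i i₀).1.symm.trans h.1) h0
      · exact h
  c3 a := by ext b; simp
  trans_G a b c h h' := ⟨h.1.trans h'.1, h.2.trans h'.2⟩
  serial_G a := ⟨(a.1, a.2 + 1), rfl, Nat.lt_succ_self _⟩
  converse_H a b := Iff.rfl
  c4 a b c h h' := by
    rcases lt_trichotomy b.2 c.2 with h'' | h'' | h''
    · exact Or.inl ⟨h.1.symm.trans h'.1, h''⟩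
    · exact Or.inr (Or.inl (Prod.ext (h.1.symm.trans h'.1) h''))
    · exact Or.inr (Or.inr ⟨h'.1.symm.trans h.1, h''⟩)
  c5 a b c h h' := by
    rcases lt_trichotomy c.2 b.2 with h'' | h'' | h''
    · exact Or.inl ⟨h'.1.trans h.1.symm, h''⟩
    · exact Or.inr (Or.inl (Prod.ext (h.1.trans h'.1.symm) h''.symm))
    · exact Or.inr (Or.inr ⟨h.1.trans h'.1.symm, h''⟩)
  c6 := by
    rintro a c ⟨b, ⟨h₁, h₂⟩, h₃, h₄⟩
    -- As `b` lies after moment 0, `R_□ b c` forces `b = c`, so `a` itself is the witness.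
    refine ⟨a, fun i => (equivalence_atMomentZero (M.equiv_agent i)).refl a, ?_, h₃ ▸ h₂⟩
    rcases h₄ with h₄ | h₄
    · omega
    · exact h₁.trans h₄
  c7 a b h h' := h'.2.ne h.1
  V p := {a | a.1 ∈ M.V p}

theorem atMomentZero_zero {W : Type u} {r : W → W → Prop} (h : Equivalence r) (w : W)
    (b : W × ℕ) : atMomentZero r (w, 0) b ↔ ∃ v, b = (v, 0) ∧ r w v := by
  obtain ⟨v, k⟩ := b
  constructor
  · rintro ⟨h₁, h₂⟩
    refine ⟨v, Prod.ext rfl h₁.symm, ?_⟩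
    rcases h₂ with h₂ | h₂
    · exact h₂.2
    · obtain rfl : w = v := h₂
      exact h.refl _
  · rintro ⟨v, h₁, h₂⟩
    rw [h₁]
    exact ⟨rfl, Or.inl ⟨rfl, h₂⟩⟩

/-! ### Proof search states -/

theorem exists_cons_cons {α : Type*} {s : Multiset α} {a b : α} (hab : a ≠ b) (ha : a ∈ s)
    (hb : b ∈ s) : ∃ t, s = a ::ₘ b ::ₘ t := by
  obtain ⟨t, rfl⟩ := Multiset.exists_cons_of_mem ha
  obtain ⟨t, rfl⟩ := Multiset.exists_cons_of_mem
    ((Multiset.mem_cons.1 hb).resolve_left hab.symm)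
  exact ⟨t, rfl⟩

/-- The labelled formula has been analysed: the formulas that its rule would add have already
been added. Literals and the formulas kept by their rules are never discarded. -/
def Reduced {n : ℕ} (𝓡 : Multiset (RelAtom n)) (X : Set (LFormula n)) : LFormula n → Prop
  | ⟨w, .and φ ψ⟩ => ⟨w, φ⟩ ∈ X ∨ ⟨w, ψ⟩ ∈ X
  | ⟨w, .or φ ψ⟩ => ⟨w, φ⟩ ∈ X ∧ ⟨w, ψ⟩ ∈ X
  | ⟨w, .box φ⟩ => ∃ v, .box w v ∈ 𝓡 ∧ ⟨v, φ⟩ ∈ X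
  | ⟨w, .stit i φ⟩ => ∃ v, .agent i w v ∈ 𝓡 ∧ ⟨v, φ⟩ ∈ X
  | _ => False

theorem Reduced.mono {n : ℕ} {𝓡 𝓡' : Multiset (RelAtom n)} {X X' : Set (LFormula n)}
    (h𝓡 : 𝓡 ≤ 𝓡') (hX : X ⊆ X') {f : LFormula n} (h : Reduced 𝓡 X f) : Reduced 𝓡' X' f := by
  obtain ⟨w, φ⟩ := f
  cases φ with
  | and φ ψ => exact h.imp (@hX _) (@hX _)
  | or φ ψ => exact h.imp (@hX _) (@hX _)
  | box φ => exact h.imp fun v hv => ⟨Multiset.mem_of_le h𝓡 hv.1, hX hv.2⟩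
  | stit i φ => exact h.imp fun v hv => ⟨Multiset.mem_of_le h𝓡 hv.1, hX hv.2⟩
  | _ => exact h

/-- An underivable sequent on a branch of a proof search, with the set of all labelled formulas
that occur on the branch so far. -/
structure SearchState (n : ℕ) where
  rels : Multiset (RelAtom n)
  goals : Multiset (LFormula n)
  seen : Set (LFormula n)
  not_derivable : ¬ G3Ldm rels goals
  seen_cases : ∀ f ∈ seen, f ∈ goals ∨ Reduced rels seen f

namespace SearchState

variable {n : ℕ}

/-- Goals are not compared, since rules may discard their principal formula; atoms and seen formulas
only accumulate. -/
instance : Preorder (SearchState n) := Preorder.lift fun S => (S.rels, S.seen)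

theorem exists_add_rels (S : SearchState n) (M : Multiset (RelAtom n))
    (h : ¬ G3Ldm (M + S.rels) S.goals) : ∃ T, S ≤ T ∧ T.rels = M + S.rels :=
  ⟨⟨M + S.rels, S.goals, S.seen, h, fun f hf => (S.seen_cases f hf).imp_right
    (Reduced.mono (Multiset.le_add_left _ _) subset_rfl)⟩,
    ⟨Multiset.le_add_left _ _, subset_rfl⟩, rfl⟩

theorem exists_cons_rels (S : SearchState n) (a : RelAtom n)
    (h : G3Ldm (a ::ₘ S.rels) S.goals → G3Ldm S.rels S.goals) :
    ∃ T, S ≤ T ∧ T.rels = a ::ₘ S.rels :=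
  S.exists_add_rels {a} fun h' => S.not_derivable (h h')

/-! ### Relational rules -/

theorem exists_box_refl (S : SearchState n) (w : Label) :
    ∃ T, S ≤ T ∧ T.rels = .box w w ::ₘ S.rels :=
  S.exists_cons_rels _ (G3Ldm.reflBox _ _ _)

theorem exists_agent_refl (S : SearchState n) (i : Fin n) (w : Label) :
    ∃ T, S ≤ T ∧ T.rels = .agent i w w ::ₘ S.rels :=
  S.exists_cons_rels _ (G3Ldm.reflAgent _ _ _ _)

theorem exists_box_eucl (S : SearchState n) {w u v : Label} (hu : .box w u ∈ S.rels)
    (hv : .box w v ∈ S.rels) : ∃ T, S ≤ T ∧ T.rels = .box u v ::ₘ S.rels := by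
  -- If `u = v`, the Euclidean rule would need two copies of the atom; reflexivity yields the same
  -- new atom.
  by_cases huv : u = v
  · exact huv ▸ S.exists_box_refl u
  refine S.exists_cons_rels _ fun h => ?_
  obtain ⟨t, ht⟩ := exists_cons_cons (by simpa using huv) hu hv
  rw [ht] at h ⊢
  refine G3Ldm.euclBox _ _ _ _ _ ?_
  rwa [Multiset.cons_swap (RelAtom.box w v), Multiset.cons_swap (RelAtom.box w u)]

theorem exists_agent_eucl (S : SearchState n) {i : Fin n} {w u v : Label}
    (hu : .agent i w u ∈ S.rels) (hv : .agent i w v ∈ S.rels) :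
    ∃ T, S ≤ T ∧ T.rels = .agent i u v ::ₘ S.rels := by
  by_cases huv : u = v
  · exact huv ▸ S.exists_agent_refl i u
  refine S.exists_cons_rels _ fun h => ?_
  obtain ⟨t, ht⟩ := exists_cons_cons (by simpa using huv) hu hv
  rw [ht] at h ⊢
  refine G3Ldm.euclAgent _ _ _ _ _ _ ?_
  rwa [Multiset.cons_swap (RelAtom.agent i w v), Multiset.cons_swap (RelAtom.agent i w u)]

theorem exists_bridge (S : SearchState n) {i : Fin n} {w u : Label}
    (hu : .agent i w u ∈ S.rels) : ∃ T, S ≤ T ∧ T.rels = .box w u ::ₘ S.rels := by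
  refine S.exists_cons_rels _ fun h => ?_
  obtain ⟨t, ht⟩ := Multiset.exists_cons_of_mem hu
  rw [ht] at h ⊢
  exact G3Ldm.br _ _ _ _ _ h

/-- Another copy of an atom `R_□ w u` can be obtained from the reflexivity and Euclidean rules. -/
theorem exists_box_copy (S : SearchState n) {w u : Label} (hu : .box w u ∈ S.rels) :
    ∃ T, S ≤ T ∧ .box w u ::ₘ S.rels ≤ T.rels := by
  -- The atoms added in turn are `R_□ w w`, `R_□ u w`, `R_□ u u`, `R_□ w u`.
  obtain ⟨T₁, h₁, e₁⟩ := S.exists_box_refl w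
  obtain ⟨T₂, h₂, e₂⟩ := T₁.exists_box_eucl (Multiset.mem_of_le h₁.1 hu) (v := w) (by simp [e₁])
  obtain ⟨T₃, h₃, e₃⟩ := T₂.exists_box_refl u
  obtain ⟨T₄, h₄, e₄⟩ := T₃.exists_box_eucl (w := u) (u := w) (v := u) (by simp [e₃, e₂])
    (by simp [e₃])
  have h : S ≤ T₃ := h₁.trans (h₂.trans h₃)
  exact ⟨T₄, h.trans h₄, e₄ ▸ Multiset.cons_le_cons _ h.1⟩

/-- The rule `ioa` counts its atoms with multiplicity, so a non-injective `u` needs repeated copies,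
and contraction is not a rule. -/
theorem exists_box_copies (S : SearchState n) (w : Label) (M : Multiset Label)
    (hM : ∀ u ∈ M, .box w u ∈ S.rels) :
    ∃ T, S ≤ T ∧ M.map (RelAtom.box w) ≤ T.rels := by
  suffices ∃ T, S ≤ T ∧ M.map (RelAtom.box w) + S.rels ≤ T.rels from
    this.imp fun T h => ⟨h.1, (Multiset.le_add_right _ _).trans h.2⟩
  induction M using Multiset.induction with
  | empty => exact ⟨S, le_rfl, by simp⟩
  | cons u M ih =>
    obtain ⟨T, h, hT⟩ := ih fun u' hu' => hM u' (Multiset.mem_cons_of_mem hu')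
    obtain ⟨T', h', hT'⟩ := T.exists_box_copy
      (Multiset.mem_of_le h.1 (hM u (Multiset.mem_cons_self _ _)))
    refine ⟨T', h.trans h', le_trans ?_ hT'⟩
    rw [Multiset.map_cons, Multiset.cons_add]
    exact Multiset.cons_le_cons _ hT

theorem exists_fresh (𝓡 : Multiset (RelAtom n)) (Γ : Multiset (LFormula n)) :
    ∃ v, Fresh v 𝓡 Γ := by
  have h₁ : (⋃ a ∈ {a | a ∈ 𝓡}, {v | a.Mentions v}).Finite := by
    refine 𝓡.finite_toSet.biUnion fun a _ => ?_
    cases a with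
    | box x y => exact Set.toFinite {x, y}
    | agent i x y => exact Set.toFinite {x, y}
  have h₂ : (LFormula.label '' {f | f ∈ Γ}).Finite := Γ.finite_toSet.image _
  obtain ⟨v, hv⟩ := (h₁.union h₂).exists_notMem
  simp only [Set.mem_union, Set.mem_iUnion, Set.mem_image, Set.mem_ofPred_eq, not_or,
    not_exists, not_and] at hv
  exact ⟨v, hv.1, fun f hf h => hv.2 f hf h.symm⟩

theorem exists_ioa (S : SearchState n) (w : Label) (u : Fin n → Label)
    (hu : ∀ i, .box w (u i) ∈ S.rels) :
    ∃ T, S ≤ T ∧ ∃ v, ∀ i, .agent i (u i) v ∈ T.rels := by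
  obtain ⟨S', hS', hle⟩ := S.exists_box_copies w ((Finset.univ : Finset (Fin n)).val.map u)
    (by simpa using hu)
  replace hle : ioaBox w u ≤ S'.rels := by
    rwa [Multiset.map_map] at hle
  obtain ⟨𝓡, h𝓡⟩ := Multiset.le_iff_exists_add.1 hle
  obtain ⟨v, hv⟩ := exists_fresh S'.rels S'.goals
  obtain ⟨T, hT, e⟩ := S'.exists_add_rels (ioaAgent u v) fun h => S'.not_derivable (by
    rw [h𝓡] at h hv ⊢
    refine G3Ldm.ioa _ _ _ _ _ hv ?_
    rwa [add_comm (ioaBox w u), add_assoc])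
  refine ⟨T, hS'.trans hT, v, fun i => ?_⟩
  rw [e]
  exact Multiset.mem_add.2 (Or.inl (Multiset.mem_map_of_mem _ (Finset.mem_univ i)))

/-! ### Logical rules -/

/-- Replace a goal `f` by other goals, possibly adding atoms, so that `f` becomes reduced. -/
theorem exists_reduce (S : SearchState n) {f : LFormula n} {Γ : Multiset (LFormula n)}
    (hΓ : S.goals = f ::ₘ Γ) (M : Multiset (RelAtom n)) (Δ : Multiset (LFormula n))
    (hd : ¬ G3Ldm (M + S.rels) (Δ + Γ))
    (hf : Reduced (M + S.rels) (S.seen ∪ {g | g ∈ Δ}) f ∨ f ∈ Δ) :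
    ∃ T, S ≤ T ∧ T.rels = M + S.rels ∧ T.seen = S.seen ∪ {g | g ∈ Δ} := by
  refine ⟨⟨M + S.rels, Δ + Γ, S.seen ∪ {g | g ∈ Δ}, hd, fun g hg => ?_⟩,
    ⟨Multiset.le_add_left _ _, Set.subset_union_left⟩, rfl, rfl⟩
  rcases hg with hg | hg
  · rcases S.seen_cases g hg with h | h
    · rw [hΓ] at h
      rcases Multiset.mem_cons.1 h with rfl | h
      · exact hf.symm.imp_left fun h => Multiset.mem_add.2 (Or.inl h)
      · exact Or.inl (Multiset.mem_add.2 (Or.inr h))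
    · exact Or.inr (h.mono (Multiset.le_add_left _ _) Set.subset_union_left)
  · exact Or.inl (Multiset.mem_add.2 (Or.inl hg))

/-- The formulas that are discarded by their rules. -/
def _root_.Stit.Formula.Discardable : Formula n → Prop
  | .and _ _ | .or _ _ | .box _ | .stit _ _ => True
  | _ => False

/-- Literals and diamond formulas are never `Reduced`, so they stay goals forever. -/
theorem mem_goals (S : SearchState n) {w : Label} {φ : Formula n} (h : ⟨w, φ⟩ ∈ S.seen)
    (hφ : ¬ φ.Discardable) : ⟨w, φ⟩ ∈ S.goals := by
  refine (S.seen_cases _ h).resolve_right fun h' => ?_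
  cases φ <;> first | exact hφ trivial | exact h'

theorem exists_reduced (S : SearchState n) {w : Label} {φ : Formula n} (h : ⟨w, φ⟩ ∈ S.seen)
    (hφ : φ.Discardable) : ∃ T, S ≤ T ∧ Reduced T.rels T.seen ⟨w, φ⟩ := by
  rcases S.seen_cases _ h with h | h
  swap
  · exact ⟨S, le_rfl, h⟩
  obtain ⟨Γ, hΓ⟩ := Multiset.exists_cons_of_mem h
  have hS := S.not_derivable
  rw [hΓ] at hS
  suffices ∃ M Δ, ¬ G3Ldm (M + S.rels) (Δ + Γ) ∧
      Reduced (M + S.rels) (S.seen ∪ {g | g ∈ Δ}) ⟨w, φ⟩ by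
    obtain ⟨M, Δ, hd, hr⟩ := this
    obtain ⟨T, hT, e₁, e₂⟩ := S.exists_reduce hΓ M Δ hd (Or.inl hr)
    exact ⟨T, hT, by rwa [e₁, e₂]⟩
  cases φ with
  | and φ ψ =>
    -- At least one premise is underivable; the branch follows it.
    by_cases hd : G3Ldm S.rels (⟨w, φ⟩ ::ₘ Γ)
    · refine ⟨0, {⟨w, ψ⟩}, fun hd' => hS (.and _ _ _ _ _ hd ?_), Or.inr (Or.inr (by simp))⟩
      rwa [zero_add] at hd'
    · refine ⟨0, {⟨w, φ⟩}, ?_, Or.inl (Or.inr (by simp))⟩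
      rwa [zero_add]
  | or φ ψ =>
    refine ⟨0, ⟨w, φ⟩ ::ₘ {⟨w, ψ⟩}, fun hd => hS (.or _ _ _ _ _ ?_),
      Or.inr (by simp), Or.inr (by simp)⟩
    rwa [zero_add, Multiset.cons_add, Multiset.singleton_add] at hd
  | box φ =>
    obtain ⟨v, hv⟩ := exists_fresh S.rels (⟨w, .box φ⟩ ::ₘ Γ)
    exact ⟨{.box w v}, {⟨v, φ⟩}, fun hd => hS (.box _ _ _ _ _ hv hd), v, by simp,
      Or.inr (by simp)⟩
  | stit i φ =>
    obtain ⟨v, hv⟩ := exists_fresh S.rels (⟨w, .stit i φ⟩ ::ₘ Γ)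
    exact ⟨{.agent i w v}, {⟨v, φ⟩}, fun hd => hS (.stit _ _ _ _ _ _ hv hd), v, by simp,
      Or.inr (by simp)⟩
  | _ => exact hφ.elim

/-- The rule keeps its principal formula, which thus remains available for atoms that appear later.
-/
theorem exists_dia (S : SearchState n) {w u : Label} {φ : Formula n}
    (h : ⟨w, .dia φ⟩ ∈ S.seen) (hu : .box w u ∈ S.rels) :
    ∃ T, S ≤ T ∧ ⟨u, φ⟩ ∈ T.seen := by
  obtain ⟨Γ, hΓ⟩ := Multiset.exists_cons_of_mem (S.mem_goals h id)
  obtain ⟨𝓡, h𝓡⟩ := Multiset.exists_cons_of_mem hu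
  obtain ⟨T, hT, -, e⟩ := S.exists_reduce hΓ 0 (⟨u, φ⟩ ::ₘ {⟨w, .dia φ⟩}) (fun hd =>
    S.not_derivable (by
      rw [zero_add, h𝓡, Multiset.cons_add, Multiset.singleton_add] at hd
      rw [hΓ, h𝓡]
      exact .dia _ _ _ _ _ hd)) (Or.inr (by simp))
  exact ⟨T, hT, e ▸ Or.inr (by simp)⟩

theorem exists_posStit (S : SearchState n) {i : Fin n} {w u : Label} {φ : Formula n}
    (h : ⟨w, .posStit i φ⟩ ∈ S.seen) (hu : .agent i w u ∈ S.rels) :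
    ∃ T, S ≤ T ∧ ⟨u, φ⟩ ∈ T.seen := by
  obtain ⟨Γ, hΓ⟩ := Multiset.exists_cons_of_mem (S.mem_goals h id)
  obtain ⟨𝓡, h𝓡⟩ := Multiset.exists_cons_of_mem hu
  obtain ⟨T, hT, -, e⟩ := S.exists_reduce hΓ 0 (⟨u, φ⟩ ::ₘ {⟨w, .posStit i φ⟩}) (fun hd =>
    S.not_derivable (by
      rw [zero_add, h𝓡, Multiset.cons_add, Multiset.singleton_add] at hd
      rw [hΓ, h𝓡]
      exact .posStit _ _ _ _ _ _ hd)) (Or.inr (by simp))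
  exact ⟨T, hT, e ▸ Or.inr (by simp)⟩

theorem not_pos_and_neg (S : SearchState n) {w : Label} {p : PVar}
    (hp : ⟨w, .pos p⟩ ∈ S.seen) (hn : ⟨w, .neg p⟩ ∈ S.seen) : False := by
  obtain ⟨Γ, hΓ⟩ := exists_cons_cons (by simp) (S.mem_goals hp id) (S.mem_goals hn id)
  exact S.not_derivable (hΓ ▸ .id _ _ _ _)

end SearchState

/-! ### Completeness -/

/-- The properties of search states that a saturated branch has to decide. -/
def SearchState.Decides {n : ℕ} :
    RelAtom n ⊕ LFormula n ⊕ LFormula n ⊕ (Fin n → Label) → SearchState n → Prop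
  | .inl a, S => a ∈ S.rels
  | .inr (.inl f), S => f ∈ S.seen
  | .inr (.inr (.inl f)), S => Reduced S.rels S.seen f
  | .inr (.inr (.inr u)), S => ∃ v, ∀ i, .agent i (u i) v ∈ S.rels

/-- The set of atoms and the set of labelled formulas that occur on a saturated open branch. -/
structure Saturated {n : ℕ} (A : Set (RelAtom n)) (X : Set (LFormula n)) : Prop where
  box_refl : ∀ w, .box w w ∈ A
  box_eucl : ∀ w u v, .box w u ∈ A → .box w v ∈ A → .box u v ∈ A
  agent_refl : ∀ i w, .agent i w w ∈ A
  agent_eucl : ∀ i w u v, .agent i w u ∈ A → .agent i w v ∈ A → .agent i u v ∈ A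
  bridge : ∀ i w u, .agent i w u ∈ A → .box w u ∈ A
  ioa : ∀ (w : Label) (u : Fin n → Label), (∀ i, .box w (u i) ∈ A) → ∃ v, ∀ i, .agent i (u i) v ∈ A
  literal : ∀ w p, ⟨w, .pos p⟩ ∈ X → ⟨w, .neg p⟩ ∈ X → False
  and : ∀ w φ ψ, ⟨w, .and φ ψ⟩ ∈ X → ⟨w, φ⟩ ∈ X ∨ ⟨w, ψ⟩ ∈ X
  or : ∀ w φ ψ, ⟨w, .or φ ψ⟩ ∈ X → ⟨w, φ⟩ ∈ X ∧ ⟨w, ψ⟩ ∈ X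
  box : ∀ w φ, ⟨w, .box φ⟩ ∈ X → ∃ v, .box w v ∈ A ∧ ⟨v, φ⟩ ∈ X
  dia : ∀ w u φ, ⟨w, .dia φ⟩ ∈ X → .box w u ∈ A → ⟨u, φ⟩ ∈ X
  stit : ∀ i w φ, ⟨w, .stit i φ⟩ ∈ X → ∃ v, .agent i w v ∈ A ∧ ⟨v, φ⟩ ∈ X
  posStit : ∀ i w u φ, ⟨w, .posStit i φ⟩ ∈ X → .agent i w u ∈ A → ⟨u, φ⟩ ∈ X

/-- Atoms and seen formulas persist, so each requirement, once triggered, is attainable from every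
later stage, and genericity meets it. Witness labels and chosen conjuncts may vary with the stage,
so they are quantified inside the decided property. -/
theorem SearchState.exists_saturated {n : ℕ} (S : SearchState n) :
    ∃ A X, Saturated A X ∧ S.seen ⊆ X := by
  obtain ⟨s, hs, h0, hgen⟩ := exists_generic_sequence SearchState.Decides S
  have rel_mono : ∀ {a : RelAtom n} {k l}, k ≤ l → a ∈ (s k).rels → a ∈ (s l).rels :=
    fun hkl h => Multiset.mem_of_le (hs hkl).1 h
  have seen_mono : ∀ {f : LFormula n} {k l}, k ≤ l → f ∈ (s k).seen → f ∈ (s l).seen :=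
    fun hkl h => (hs hkl).2 h
  have gen_rel : ∀ (a : RelAtom n) (k₀ : ℕ),
      (∀ k ≥ k₀, ∃ T, s k ≤ T ∧ T.rels = a ::ₘ (s k).rels) → ∃ k, a ∈ (s k).rels :=
    fun a k₀ h => hgen (.inl a) ⟨k₀, fun k hk =>
      (h k hk).imp fun T hT => ⟨hT.1, by simp [SearchState.Decides, hT.2]⟩⟩
  have gen_seen : ∀ (f : LFormula n) (k₀ : ℕ),
      (∀ k ≥ k₀, ∃ T, s k ≤ T ∧ f ∈ T.seen) → ∃ k, f ∈ (s k).seen :=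
    fun f k₀ h => hgen (.inr (.inl f)) ⟨k₀, h⟩
  have gen_red : ∀ (w : Label) (φ : Formula n) (k₀ : ℕ), φ.Discardable →
      ⟨w, φ⟩ ∈ (s k₀).seen → ∃ k, Reduced (s k).rels (s k).seen ⟨w, φ⟩ :=
    fun w φ k₀ hφ h => hgen (.inr (.inr (.inl ⟨w, φ⟩)))
      ⟨k₀, fun k hk => (s k).exists_reduced (seen_mono hk h) hφ⟩
  refine ⟨{a | ∃ k, a ∈ (s k).rels}, {f | ∃ k, f ∈ (s k).seen}, ?_,
    fun f hf => ⟨0, h0 ▸ hf⟩⟩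
  constructor
  · exact fun w => gen_rel _ 0 fun k _ => (s k).exists_box_refl w
  · rintro w u v ⟨k, hk⟩ ⟨l, hl⟩
    exact gen_rel _ (max k l) fun m hm => (s m).exists_box_eucl
      (rel_mono (le_of_max_le_left hm) hk) (rel_mono (le_of_max_le_right hm) hl)
  · exact fun i w => gen_rel _ 0 fun k _ => (s k).exists_agent_refl i w
  · rintro i w u v ⟨k, hk⟩ ⟨l, hl⟩
    exact gen_rel _ (max k l) fun m hm => (s m).exists_agent_eucl
      (rel_mono (le_of_max_le_left hm) hk) (rel_mono (le_of_max_le_right hm) hl)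
  · rintro i w u ⟨k, hk⟩
    exact gen_rel _ k fun m hm => (s m).exists_bridge (rel_mono hm hk)
  · intro w u hu
    choose k hk using hu
    -- By stage `Finset.univ.sup k` all atoms `R_□ w (u i)` are present.
    obtain ⟨m, v, hv⟩ := hgen (.inr (.inr (.inr u))) ⟨Finset.univ.sup k, fun m hm =>
      (s m).exists_ioa w u fun i =>
        rel_mono ((Finset.le_sup (f := k) (Finset.mem_univ i)).trans hm) (hk i)⟩
    exact ⟨v, fun i => ⟨m, hv i⟩⟩
  · rintro w p ⟨k, hk⟩ ⟨l, hl⟩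
    exact (s (max k l)).not_pos_and_neg (seen_mono (le_max_left _ _) hk)
      (seen_mono (le_max_right _ _) hl)
  · rintro w φ ψ ⟨k, hk⟩
    obtain ⟨m, hm⟩ := gen_red w (.and φ ψ) k trivial hk
    exact hm.imp (fun h => ⟨m, h⟩) fun h => ⟨m, h⟩
  · rintro w φ ψ ⟨k, hk⟩
    obtain ⟨m, hm⟩ := gen_red w (.or φ ψ) k trivial hk
    exact hm.imp (fun h => ⟨m, h⟩) fun h => ⟨m, h⟩
  · rintro w φ ⟨k, hk⟩
    obtain ⟨m, v, hv⟩ := gen_red w (.box φ) k trivial hk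
    exact ⟨v, ⟨m, hv.1⟩, ⟨m, hv.2⟩⟩
  · rintro w u φ ⟨k, hk⟩ ⟨l, hl⟩
    exact gen_seen _ (max k l) fun m hm => (s m).exists_dia
      (seen_mono (le_of_max_le_left hm) hk) (rel_mono (le_of_max_le_right hm) hl)
  · rintro i w φ ⟨k, hk⟩
    obtain ⟨m, v, hv⟩ := gen_red w (.stit i φ) k trivial hk
    exact ⟨v, ⟨m, hv.1⟩, ⟨m, hv.2⟩⟩
  · rintro i w u φ ⟨k, hk⟩ ⟨l, hl⟩
    exact gen_seen _ (max k l) fun m hm => (s m).exists_posStit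
      (seen_mono (le_of_max_le_left hm) hk) (rel_mono (le_of_max_le_right hm) hl)

theorem equivalence_of_refl_of_eucl {α : Type*} {r : α → α → Prop} (hr : ∀ w, r w w)
    (he : ∀ w u v, r w u → r w v → r u v) : Equivalence r where
  refl := hr
  symm h := he _ _ _ h (hr _)
  trans h h' := he _ _ _ (he _ _ _ h (hr _)) h'

/-- The model on the set of labels given by a saturated branch. -/
def Saturated.model {n : ℕ} {A : Set (RelAtom n)} {X : Set (LFormula n)}
    (h : Saturated A X) : LdmModel n (ULift.{u} Label) where
  nonempty := ⟨⟨0⟩⟩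
  Rbox x y := .box x.down y.down ∈ A
  R i x y := .agent i x.down y.down ∈ A
  equiv_box := equivalence_of_refl_of_eucl (fun _ => h.box_refl _)
    fun _ _ _ => h.box_eucl _ _ _
  equiv_agent i := equivalence_of_refl_of_eucl (fun _ => h.agent_refl i _)
    fun _ _ _ => h.agent_eucl i _ _ _
  c1 i x y := h.bridge i _ _
  c2 u hu := by
    rcases isEmpty_or_nonempty (Fin n) with _ | ⟨⟨i₀⟩⟩
    · exact ⟨⟨0⟩, fun i => isEmptyElim i⟩
    -- The point `u i₀` serves as the root `w` of the rule.
    · obtain ⟨v, hv⟩ := h.ioa (u i₀).down (fun i => (u i).down) (hu i₀)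
      exact ⟨⟨v⟩, hv⟩
  -- Formulas of the branch must fail, so `p` holds exactly where its negation occurs.
  V p := {x | ⟨x.down, .neg p⟩ ∈ X}

/-- Every labelled formula of a saturated branch fails in its model. -/
theorem Saturated.not_sat {n : ℕ} {A : Set (RelAtom n)} {X : Set (LFormula n)}
    (h : Saturated A X) (φ : Formula n) (w : Label) (hw : ⟨w, φ⟩ ∈ X) :
    ¬ Sat h.model.{u}.toTstit (⟨w⟩, 0) φ := by
  induction φ generalizing w with
  | pos p => exact fun hs => h.literal w p hw hs
  | neg p => exact fun hs => hs hw
  | and φ ψ ihφ ihψ =>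
    rintro ⟨h₁, h₂⟩
    exact (h.and w φ ψ hw).elim (fun h' => ihφ w h' h₁) fun h' => ihψ w h' h₂
  | or φ ψ ihφ ihψ =>
    have := h.or w φ ψ hw
    exact fun hs => hs.elim (ihφ w this.1) (ihψ w this.2)
  | box φ ih =>
    obtain ⟨v, hv, hvφ⟩ := h.box w φ hw
    exact fun hs => ih v hvφ (hs _
      ((atMomentZero_zero h.model.equiv_box _ _).2 ⟨⟨v⟩, rfl, hv⟩))
  | dia φ ih =>
    rintro ⟨b, hb, hs⟩
    obtain ⟨v, rfl, hv⟩ := (atMomentZero_zero h.model.equiv_box _ _).1 hb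
    exact ih v.down (h.dia w _ φ hw hv) hs
  | stit i φ ih =>
    obtain ⟨v, hv, hvφ⟩ := h.stit i w φ hw
    exact fun hs => ih v hvφ (hs _
      ((atMomentZero_zero (h.model.equiv_agent i) _ _).2 ⟨⟨v⟩, rfl, hv⟩))
  | posStit i φ ih =>
    rintro ⟨b, hb, hs⟩
    obtain ⟨v, rfl, hv⟩ := (atMomentZero_zero (h.model.equiv_agent i) _ _).1 hb
    exact ih v.down (h.posStit i w _ φ hw hv) hs

end Stit

theorem mainTheorem4 (n : ℕ) (φ : Stit.Formula n) (hφ : Stit.Valid.{u} φ) (x : Stit.Label) :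
    Stit.G3Ldm (n := n) 0 {⟨x, φ⟩} := by
  by_contra hd
  obtain ⟨A, X, h, hX⟩ := Stit.SearchState.exists_saturated
    ⟨0, {⟨x, φ⟩}, {⟨x, φ⟩}, hd, fun f hf => Or.inl (by simpa using hf)⟩
  exact h.not_sat φ x (hX rfl) (hφ _ _ _)
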